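/- Two senders $i\in\{1,2\}$ have independent types $\omega_i\in\{0,1\}$ with $\Pr(\omega_i=1)=\mu\in(0,1)$. Each sender simultaneously offers a distribution $p_i$ of posterior beliefs, that is, a Borel probability measure on $[0,1]$ with mean $\mu$; *full information* is the distribution $p^B$ with mass $\mu$ on $1$ and $1-\mu$ on $0$. A receiver does not observe $(p_1,p_2)$. She decides (possibly at random) which sender to visit first, if any. On visiting sender $i$ she observes $p_i$, chooses a garbling $q_i$ of $p_i$ (a distribution with the same mean that second-order stochastically dominates $p_i$), pays the attention cost $$C(q_i,p_i)=k(p_i)\int_{[0,1]}(x-\mu)^2\,dq_i(x),$$ and draws her belief $x$ about $i$ from $q_i$. She then decides whether to visit the other sender $j$; if she does, she observes $p_j$, chooses a garbling $q_j$ of $p_j$ (which may depend on $x$), pays $C(q_j,p_j)$ and draws her belief about $j$ from $q_j$. Her belief about an unvisited sender is $\mu$. Finally she selects the sender about whom her belief is higher (ties may be broken in any way). Her payoff is the type of the selected sender minus the attention costs; a sender's payoff is $1$ if he is selected and $0$ otherwise; all maximize expected payoffs. Strategies are pure, except that the receiver may randomize over whom to visit first and at ties. In an *equilibrium* no sender gains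 from a unilateral deviation to another distribution, and the receiver's choice is optimal at every point of the game, on and off the path, where she expects each sender she has not yet visited to offer his equilibrium distribution. Suppose that $k$, a real-valued function of the offered distribution, is weakly decreasing in the Blackwell order: $k(p)\le k(q)$ whenever $q$ is a garbling of $p$. Let $k_F:=k(p^B)$. **Proposition (Full information equilibrium).** If $k_F>\frac12$ and $\mu\in\left[\frac{1}{4k_F},\,1-\frac{1}{4k_F}\right]$, then there is an equilibrium in which both senders offer full information. -/

import Mathlib

open MeasureTheory
open scoped unitInterval

noncomputable section

namespace DisclosureGame

/-- Bayes-plausible distributions of posterior beliefs: Borel probability measures on `[0,1]`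
whose mean is the prior `μ`. -/
structure PosteriorDist (μ : I) where
  toMeasure : Measure I
  isProb : IsProbabilityMeasure toMeasure
  mean_eq : ∫ x, (x : ℝ) ∂toMeasure = μ

/-- `q` is a garbling (mean preserving contraction) of `p`, i.e. `p` is weakly more Blackwell
informative than `q`: the two have the same mean (namely `μ`, by their type) and `q` second order
stochastically dominates `p`, in terms of integrated cumulative distribution functions. -/
def IsGarbling {μ : I} (q p : PosteriorDist μ) : Prop :=
  ∀ t ∈ Set.Icc (0 : ℝ) 1,
    ∫ s in (0 : ℝ)..t, q.toMeasure.real {x : I | (x : ℝ) ≤ s} ≤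
      ∫ s in (0 : ℝ)..t, p.toMeasure.real {x : I | (x : ℝ) ≤ s}

/-- Full information: the posterior is `1` with probability `μ` and `0` with
probability `1 - μ`. -/
def fullInfo (μ : I) : PosteriorDist μ where
  toMeasure := ENNReal.ofReal (1 - (μ : ℝ)) • Measure.dirac (0 : I) +
    ENNReal.ofReal (μ : ℝ) • Measure.dirac (1 : I)
  isProb := by
    constructor
    have h0 := μ.2.1
    have h1 : (0 : ℝ) ≤ 1 - μ := sub_nonneg.2 μ.2.2
    simp [← ENNReal.ofReal_add h1 h0]
  mean_eq := by
    have h0 := μ.2.1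
    have hi : ∀ a : I, ∀ c : ℝ,
        Integrable (fun x : I => (x : ℝ)) (ENNReal.ofReal c • Measure.dirac a) := fun a c =>
      (integrable_dirac (by simp)).smul_measure ENNReal.ofReal_ne_top
    rw [integral_add_measure (hi 0 _) (hi 1 _)]
    simp [h0]

/-- The other sender. -/
def other (i : Fin 2) : Fin 2 := 1 - i

/-- A strategy of the receiver. It may randomize only over whom to visit first, if anyone, and
between senders about whom the final beliefs are equal. -/
structure ReceiverStrategy (μ : I) where
  /-- probabilities of visiting nobody (`none`) and of visiting sender `i` first (`some i`) -/
  order : PMF (Option (Fin 2))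
  /-- the garbling chosen for sender `i`, visited first, if he turns out to offer `p` -/
  garble₁ : Fin 2 → PosteriorDist μ → PosteriorDist μ
  garble₁_isGarbling : ∀ i p, IsGarbling (garble₁ i p) p
  /-- if sender `i` is visited first and the belief `x` is drawn, the other sender is visited
  exactly when `x ∈ goOn i` -/
  goOn : Fin 2 → Set I
  measurableSet_goOn : ∀ i, MeasurableSet (goOn i)
  /-- the garbling chosen for the sender visited second if he turns out to offer `p`, when
  sender `i` was visited first and the belief drawn about `i` was `x` -/
  garble₂ : Fin 2 → PosteriorDist μ → I → PosteriorDist μ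
  garble₂_isGarbling : ∀ i p x, IsGarbling (garble₂ i p x) p
  measurable_garble₂ : ∀ i p, Measurable fun x => (garble₂ i p x).toMeasure
  /-- probability of selecting sender `0` if nobody is visited (both beliefs are then `μ`) -/
  selectUnvisited : I
  /-- probability of selecting sender `i`, when visited first, if the two final beliefs are
  equal -/
  tie : Fin 2 → I

/-- Attention cost of the garbling `q` of an offered distribution `p`. -/
def cost {μ : I} (k : PosteriorDist μ → ℝ) (p q : PosteriorDist μ) : ℝ :=
  k p * ∫ x, ((x : ℝ) - μ) ^ 2 ∂q.toMeasure

/-- The receiver's expected payoff from stage 2 on, when her belief about the sender visited first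
is `x` and she chooses the garbling `q` of the distribution `p` of the sender visited second. She
selects the sender about whom her belief is higher. -/
def stage₂Payoff {μ : I} (k : PosteriorDist μ → ℝ) (x : I) (p q : PosteriorDist μ) : ℝ :=
  (∫ y, max (x : ℝ) (y : ℝ) ∂q.toMeasure) - cost k p q

open Classical in
/-- The receiver's continuation payoff after the belief `x` was drawn about sender `i`, visited
first, when the other sender offers `p`. A sender who is not visited is believed to be good with
probability `μ`. -/
def continuation {μ : I} (k : PosteriorDist μ → ℝ) (ρ : ReceiverStrategy μ) (i : Fin 2)
    (p : PosteriorDist μ) (x : I) : ℝ :=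
  if x ∈ ρ.goOn i then stage₂Payoff k x p (ρ.garble₂ i p x) else max (x : ℝ) (μ : ℝ)

/-- The receiver's expected payoff when she visits sender `i` first, he offers `p`, she chooses the
garbling `q` of `p`, and then follows `ρ`, the other sender offering `p'`. -/
def stage₁Payoff {μ : I} (k : PosteriorDist μ → ℝ) (ρ : ReceiverStrategy μ) (i : Fin 2)
    (p p' q : PosteriorDist μ) : ℝ :=
  (∫ x, continuation k ρ i p' x ∂q.toMeasure) - cost k p q

/-- The receiver's expected payoff from visiting nobody, or sender `i` first, and then following
`ρ`, when the senders offer `P`. -/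
def orderPayoff {μ : I} (k : PosteriorDist μ → ℝ) (P : Fin 2 → PosteriorDist μ)
    (ρ : ReceiverStrategy μ) : Option (Fin 2) → ℝ
  | none => μ
  | some i => stage₁Payoff k ρ i (P i) (P (other i)) (ρ.garble₁ i (P i))

/-- Optimality of the receiver's strategy wherever she has to move. As long as she has not visited
a sender she does not observe his distribution, and expects him to offer his equilibrium
distribution `P i`, also after the other sender has turned out to have deviated. -/
structure ReceiverOptimal {μ : I} (k : PosteriorDist μ → ℝ) (P : Fin 2 → PosteriorDist μ)
    (ρ : ReceiverStrategy μ) : Prop where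
  /-- the garbling at stage 2, for every observed distribution and every previous belief -/
  garble₂_opt : ∀ (i : Fin 2) (p : PosteriorDist μ) (x : I) (q : PosteriorDist μ),
    IsGarbling q p → stage₂Payoff k x p q ≤ stage₂Payoff k x p (ρ.garble₂ i p x)
  /-- the decision whether to visit the second sender, after every belief drawn about the first -/
  goOn_opt : ∀ (i : Fin 2) (x : I),
    stage₂Payoff k x (P (other i)) (ρ.garble₂ i (P (other i)) x) ≤
        continuation k ρ i (P (other i)) x ∧
      max (x : ℝ) (μ : ℝ) ≤ continuation k ρ i (P (other i)) x
  /-- the garbling at stage 1, for every observed distribution -/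
  garble₁_opt : ∀ (i : Fin 2) (p q : PosteriorDist μ), IsGarbling q p →
    stage₁Payoff k ρ i p (P (other i)) q ≤ stage₁Payoff k ρ i p (P (other i)) (ρ.garble₁ i p)
  /-- whom to visit first, if anyone -/
  order_opt : ∀ o ∈ ρ.order.support, ∀ o' : Option (Fin 2),
    orderPayoff k P ρ o' ≤ orderPayoff k P ρ o

/-- Probability that the sender visited first is selected, given final beliefs `x` about him and
`y` about the other sender; `τ` is used if they are equal. -/
def selectFirst (τ x y : I) : ℝ :=
  if y < x then 1 else if x < y then 0 else τ

open Classical in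
/-- Probability that sender `i` is selected, given that he is visited first, offers `p`, and the
other sender offers `p'`. -/
def winFirst {μ : I} (ρ : ReceiverStrategy μ) (i : Fin 2) (p p' : PosteriorDist μ) : ℝ :=
  ∫ x, (if x ∈ ρ.goOn i then
      ∫ y, selectFirst (ρ.tie i) x y ∂(ρ.garble₂ i p' x).toMeasure
    else selectFirst (ρ.tie i) x μ) ∂(ρ.garble₁ i p).toMeasure

/-- Probability that sender `i` is selected when the senders offer `P`, conditional on nobody
(`none`) or sender `j` (`some j`) being visited first. -/
def winGiven {μ : I} (P : Fin 2 → PosteriorDist μ) (ρ : ReceiverStrategy μ) (i : Fin 2) :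
    Option (Fin 2) → ℝ
  | none => if i = 0 then (ρ.selectUnvisited : ℝ) else 1 - ρ.selectUnvisited
  | some j =>
    if i = j then winFirst ρ j (P j) (P (other j)) else 1 - winFirst ρ j (P j) (P (other j))

/-- Sender `i`'s expected payoff: the probability that he is selected. -/
def senderPayoff {μ : I} (P : Fin 2 → PosteriorDist μ) (ρ : ReceiverStrategy μ) (i : Fin 2) : ℝ :=
  ∑ o : Option (Fin 2), (ρ.order o).toReal * winGiven P ρ i o

/-- The senders' distributions `P` and the receiver's strategy `ρ` form an equilibrium: the
receiver behaves optimally at every stage, on and off the path, and no sender gains from offering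
another distribution. -/
def IsEquilibrium {μ : I} (k : PosteriorDist μ → ℝ) (P : Fin 2 → PosteriorDist μ)
    (ρ : ReceiverStrategy μ) : Prop :=
  ReceiverOptimal k P ρ ∧
    ∀ (i : Fin 2) (p : PosteriorDist μ),
      senderPayoff (Function.update P i p) ρ i ≤ senderPayoff P ρ i

end DisclosureGame

end

namespace DisclosureGame

open Set Filter Topology

/-! Put `δ = 1 / (4 k_F)`; the hypothesis on `μ` says that `μ - δ` and `μ + δ` lie in `[0,1]`. The
receiver visits either sender first with probability 1/2. A first sender who offers full information
is garbled to the even spread on `μ ± δ`, after which she stops; about any other first sender she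
learns nothing and applies the same spread to the second, if he offers full information. The
quadratic cost makes it immaterial which of the two she learns about: both plans yield `μ + δ / 4`.
A lone deviator therefore never gains: visited first, he is ignored and compared at `μ` with the
other's `μ ± δ`; visited second, he is never reached. Either way he still wins with probability 1/2
(`winFirst_eq_half`).

Optimality rests on concavification: an affine majorant of the payoff net of cost, evaluated at the
prior, bounds every garbling (`integral_sub_cost_le`). Full information is Blackwell-maximal, so
`k_F` is the least cost factor and the first-stage bound `stage₁Payoff_le` survives deviations.

Off the path, the second garbling must be optimal for every offer and measurable in the first
belief. An optimum exists by weak compactness and is unique (`eq_of_optimal`), so it depends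
continuously on the belief (`measurable_bestGarbling`). -/

/-! ### Measurability of weakly continuous families -/

/-- A weakly continuous family of probability measures is measurable. -/
theorem measurable_toMeasure_of_continuous {X Y : Type*} [TopologicalSpace X] [MeasurableSpace X]
    [BorelSpace X] [PseudoEMetricSpace Y] [MeasurableSpace Y] [BorelSpace Y]
    {f : X → ProbabilityMeasure Y} (hf : Continuous f) :
    Measurable fun x => (f x : Measure Y) := by
  refine Measurable.measure_of_isPiSystem_of_isProbabilityMeasure (S := {s | IsClosed s})
    ((‹BorelSpace Y›.measurable_eq).trans borel_eq_generateFrom_isClosed) isPiSystem_isClosed ?_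
  intro F hF
  have hpos : ∀ n : ℕ, (0 : ℝ) < 1 / ((n : ℝ) + 1) := fun n => by positivity
  refine measurable_of_tendsto_metrizable (f := fun (n : ℕ) x =>
    ∫⁻ y, thickenedIndicator (hpos n) F y ∂(f x : Measure Y)) (fun n => ?_) ?_
  · exact ((ProbabilityMeasure.continuous_lintegral_boundedContinuousFunction
      (thickenedIndicator (hpos n) F)).comp hf).measurable
  · exact tendsto_pi_nhds.2 fun x => tendsto_lintegral_thickenedIndicator_of_isClosed _ hF hpos
      tendsto_one_div_add_atTop_nhds_zero_nat

/-- A function into a compact space is continuous if its graph is closed. -/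
theorem continuous_of_isClosed_graph {X Y : Type*} [TopologicalSpace X] [TopologicalSpace Y]
    [CompactSpace Y] {f : X → Y} (hf : IsClosed {z : X × Y | z.2 = f z.1}) : Continuous f := by
  rw [continuous_iff_isClosed]
  intro C hC
  have h := isClosedMap_fst_of_compactSpace (X := X) (Y := Y) _
    (hf.inter (hC.preimage continuous_snd))
  convert h using 1
  ext x
  simp

/-! ### Distributions of posteriors -/

variable {μ : I}

instance (p : PosteriorDist μ) : IsProbabilityMeasure p.toMeasure := p.isProb

theorem PosteriorDist.ext_toMeasure {p q : PosteriorDist μ} (h : p.toMeasure = q.toMeasure) :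
    p = q := by
  cases p; cases q; cases h; rfl

theorem integrable_of_continuous (ν : Measure I) [IsFiniteMeasure ν] {f : I → ℝ}
    (hf : Continuous f) : Integrable f ν :=
  hf.integrable_of_hasCompactSupport (HasCompactSupport.of_compactSpace f)

/-- The distribution with mass `1 - w` on `a` and `w` on `b`. -/
noncomputable def twoPoint (a b w : I) (h : (1 - (w : ℝ)) * a + w * b = μ) : PosteriorDist μ where
  toMeasure := ENNReal.ofReal (1 - (w : ℝ)) • Measure.dirac a +
    ENNReal.ofReal (w : ℝ) • Measure.dirac b
  isProb := by
    constructor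
    have h0 := w.2.1
    have h1 : (0 : ℝ) ≤ 1 - w := sub_nonneg.2 w.2.2
    simp [← ENNReal.ofReal_add h1 h0]
  mean_eq := by
    have h0 := w.2.1
    have h1 : (0 : ℝ) ≤ 1 - w := sub_nonneg.2 w.2.2
    have hi : ∀ a : I, ∀ c : ℝ,
        Integrable (fun x : I => (x : ℝ)) (ENNReal.ofReal c • Measure.dirac a) := fun a c =>
      (integrable_dirac (by simp)).smul_measure ENNReal.ofReal_ne_top
    rw [integral_add_measure (hi a _) (hi b _)]
    simp [h0, h1, h]

theorem integral_twoPoint (a b w : I) (h : (1 - (w : ℝ)) * a + w * b = μ) (f : I → ℝ) :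
    ∫ x, f x ∂(twoPoint a b w h).toMeasure = (1 - (w : ℝ)) * f a + w * f b := by
  have h0 := w.2.1
  have h1 : (0 : ℝ) ≤ 1 - w := sub_nonneg.2 w.2.2
  have hi : ∀ a : I, ∀ c : ℝ, Integrable f (ENNReal.ofReal c • Measure.dirac a) := fun a c =>
    (integrable_dirac (by simp)).smul_measure ENNReal.ofReal_ne_top
  rw [twoPoint, integral_add_measure (hi a _) (hi b _)]
  simp [h0, h1]

theorem fullInfo_eq_twoPoint : fullInfo μ = twoPoint 0 1 μ (by simp) := rfl

/-- No information. -/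
noncomputable def noInfo (μ : I) : PosteriorDist μ := twoPoint μ μ 0 (by simp)

theorem integral_noInfo (f : I → ℝ) : ∫ x, f x ∂(noInfo μ).toMeasure = f μ := by
  simp [noInfo, integral_twoPoint]

/-- The even mixture of two distributions of posteriors. -/
noncomputable def mix (p q : PosteriorDist μ) : PosteriorDist μ where
  toMeasure := (2⁻¹ : ENNReal) • (p.toMeasure + q.toMeasure)
  isProb := by
    constructor
    simp [ENNReal.inv_two_add_inv_two]
  mean_eq := by
    rw [integral_smul_measure, integral_add_measure (integrable_of_continuous _ (by fun_prop))
      (integrable_of_continuous _ (by fun_prop)), p.mean_eq, q.mean_eq]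
    simp; ring

theorem integral_mix (p q : PosteriorDist μ) {f : I → ℝ} (hf : Continuous f) :
    ∫ x, f x ∂(mix p q).toMeasure = (∫ x, f x ∂p.toMeasure + ∫ x, f x ∂q.toMeasure) / 2 := by
  rw [mix, integral_smul_measure, integral_add_measure (integrable_of_continuous _ hf)
      (integrable_of_continuous _ hf)]
  simp; ring

/-! ### Garblings -/

theorem integral_cdf (ν : Measure I) [IsFiniteMeasure ν] {t : ℝ} (ht : 0 ≤ t) :
    ∫ s in (0 : ℝ)..t, ν.real {x : I | (x : ℝ) ≤ s} = ∫ x : I, max (t - x) 0 ∂ν := by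
  have hm : MeasurableSet {z : ℝ × I | (z.2 : ℝ) ≤ z.1} :=
    measurableSet_le (by fun_prop) (by fun_prop)
  have h1 : ∀ s : ℝ, ν.real {x : I | (x : ℝ) ≤ s}
      = ∫ x : I, {z : ℝ × I | (z.2 : ℝ) ≤ z.1}.indicator (1 : ℝ × I → ℝ) (s, x) ∂ν := by
    intro s
    rw [← integral_indicator_one (measurableSet_le (by fun_prop) (by fun_prop))]
    rfl
  simp_rw [h1]
  rw [intervalIntegral_integral_swap]
  · refine integral_congr_ae (Eventually.of_forall fun x => ?_)
    have hx := x.2.1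
    change ∫ s in (0 : ℝ)..t, (Ici (x : ℝ)).indicator (1 : ℝ → ℝ) s = _
    rw [intervalIntegral.integral_of_le ht, integral_indicator_one measurableSet_Ici,
      measureReal_restrict_apply measurableSet_Ici, Measure.real]
    have : volume (Ici (x : ℝ) ∩ Ioc 0 t) = volume (Icc (x : ℝ) t) := by
      -- The two sets can differ only at `s = 0`, which matters when `x = 0`.
      apply measure_congr
      have h0 : ∀ᵐ s : ℝ, s ≠ 0 := by simp [ae_iff]
      filter_upwards [h0] with s hs
      refine propext ⟨fun h => ⟨h.1, h.2.2⟩, fun h => ⟨h.1, ?_, h.2⟩⟩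
      exact lt_of_le_of_ne (hx.trans h.1) (Ne.symm hs)
    rw [this, Real.volume_Icc, ENNReal.toReal_ofReal']
  · have : IsFiniteMeasure (volume.restrict (uIoc 0 t)) := by
      rw [uIoc_of_le ht]; infer_instance
    exact (integrable_const (1 : ℝ)).indicator hm

/-- Fubini turns integrated distribution functions into expectations of continuous test functions,
which makes the order weakly closed. -/
theorem isGarbling_iff {q p : PosteriorDist μ} :
    IsGarbling q p ↔ ∀ t ∈ Icc (0 : ℝ) 1,
      ∫ x : I, max (t - x) 0 ∂q.toMeasure ≤ ∫ x : I, max (t - x) 0 ∂p.toMeasure := by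
  refine forall₂_congr fun t ht => ?_
  rw [integral_cdf _ ht.1, integral_cdf _ ht.1]

theorem IsGarbling.refl (p : PosteriorDist μ) : IsGarbling p p := fun _ _ => le_rfl

theorem IsGarbling.trans {p q r : PosteriorDist μ} (h : IsGarbling p q) (h' : IsGarbling q r) :
    IsGarbling p r := fun t ht => (h t ht).trans (h' t ht)

theorem isGarbling_fullInfo (p : PosteriorDist μ) : IsGarbling p (fullInfo μ) := by
  refine isGarbling_iff.2 fun t ht => ?_
  -- A convex function on `[0,1]` lies below its chord, and full information attains the chord.
  calc ∫ x : I, max (t - x) 0 ∂p.toMeasure ≤ ∫ x : I, t * (1 - (x : ℝ)) ∂p.toMeasure := by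
        refine integral_mono (integrable_of_continuous _ (by fun_prop))
          (integrable_of_continuous _ (by fun_prop)) fun x => ?_
        have := x.2.1
        have := x.2.2
        have := ht.1
        have := ht.2
        exact max_le (by nlinarith) (by nlinarith)
    _ = t * (1 - μ) := by
        rw [integral_const_mul, integral_sub (integrable_const _)
          (integrable_of_continuous _ (by fun_prop)), p.mean_eq]
        simp
    _ = _ := by
        rw [fullInfo_eq_twoPoint, integral_twoPoint]
        simp [ht.1, ht.2]; ring

theorem integral_const_sub (p : PosteriorDist μ) (t : ℝ) :
    ∫ x : I, (t - x) ∂p.toMeasure = t - μ := by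
  rw [integral_sub (integrable_const _) (integrable_of_continuous _ (by fun_prop)), p.mean_eq]
  simp

theorem noInfo_isGarbling (p : PosteriorDist μ) : IsGarbling (noInfo μ) p := by
  refine isGarbling_iff.2 fun t ht => ?_
  rw [integral_noInfo]
  refine max_le ?_ (integral_nonneg fun x => le_max_right _ _)
  rw [← integral_const_sub p]
  exact integral_mono (integrable_of_continuous _ (by fun_prop))
    (integrable_of_continuous _ (by fun_prop)) fun x => le_max_left _ _

theorem mix_isGarbling {p q r : PosteriorDist μ} (hp : IsGarbling p r) (hq : IsGarbling q r) :
    IsGarbling (mix p q) r := by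
  refine isGarbling_iff.2 fun t ht => ?_
  rw [integral_mix _ _ (by fun_prop)]
  linarith [isGarbling_iff.1 hp t ht, isGarbling_iff.1 hq t ht]

/-- Two distributions with the same mean on the same two points agree. -/
theorem PosteriorDist.eq_of_ae_eq_or_eq {p q : PosteriorDist μ} {a b : I}
    (hp : ∀ᵐ x ∂p.toMeasure, x = a ∨ x = b) (hq : ∀ᵐ x ∂q.toMeasure, x = a ∨ x = b) : p = q := by
  refine PosteriorDist.ext_toMeasure (ext_of_forall_integral_eq_of_IsFiniteMeasure fun f => ?_)
  -- On two points every test function is affine, so its expectation depends on the mean alone.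
  obtain ⟨α, β, ha, hb⟩ : ∃ α β : ℝ, f a = α + β * a ∧ f b = α + β * b := by
    by_cases hab : a = b
    · exact ⟨f a, 0, by simp, by simp [hab]⟩
    · have hab' : (b : ℝ) - a ≠ 0 := sub_ne_zero.2 fun h => hab (Subtype.ext h.symm)
      refine ⟨f a - (f b - f a) / (b - a) * a, (f b - f a) / (b - a), by ring, ?_⟩
      field_simp
      ring
  have key : ∀ r : PosteriorDist μ, (∀ᵐ x ∂r.toMeasure, x = a ∨ x = b) →
      ∫ x, f x ∂r.toMeasure = α + β * μ := by
    intro r hr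
    have : ∀ᵐ x ∂r.toMeasure, f x = α + β * (x : ℝ) := by
      filter_upwards [hr] with x hx
      rcases hx with rfl | rfl <;> assumption
    rw [integral_congr_ae this, integral_add (integrable_const _)
      (integrable_of_continuous _ (by fun_prop)), integral_const_mul, r.mean_eq]
    simp
  rw [key p hp, key q hq]

/-! ### The second stage -/

/-- The conditional mean, in product form so that null sets need no separate treatment later. -/
theorem exists_mul_eq_setIntegral (ν : Measure I) [IsFiniteMeasure ν] (A : Set I) :
    ∃ a : I, ν.real A * a = ∫ x in A, (x : ℝ) ∂ν := by
  have h0 : 0 ≤ ∫ x in A, (x : ℝ) ∂ν := integral_nonneg fun x => x.2.1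
  have h1 : ∫ x in A, (x : ℝ) ∂ν ≤ ν.real A := by
    calc ∫ x in A, (x : ℝ) ∂ν ≤ ∫ _ in A, (1 : ℝ) ∂ν :=
          integral_mono (integrable_of_continuous _ (by fun_prop)) (integrable_const _)
            fun x => x.2.2
      _ = ν.real A := by simp
  rcases (measureReal_nonneg (μ := ν) (s := A)).eq_or_lt with h | h
  · exact ⟨0, by simp; linarith⟩
  · exact ⟨⟨(∫ x in A, (x : ℝ) ∂ν) / ν.real A, by positivity, (div_le_one h).2 h1⟩, by
      field_simp⟩

theorem setIntegral_sq_sub (ν : Measure I) [IsFiniteMeasure ν] {A : Set I} {a : I}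
    (ha : ν.real A * a = ∫ x in A, (x : ℝ) ∂ν) (c : ℝ) :
    ∫ x in A, ((x : ℝ) - c) ^ 2 ∂ν =
      ∫ x in A, ((x : ℝ) - a) ^ 2 ∂ν + ν.real A * ((a : ℝ) - c) ^ 2 := by
  have h : ∀ x : I, ((x : ℝ) - c) ^ 2 = ((x : ℝ) - a) ^ 2 +
      (2 * (a - c) * x + (c ^ 2 - (a : ℝ) ^ 2)) := fun x => by ring
  simp_rw [h]
  rw [integral_add (integrable_of_continuous _ (by fun_prop))
      (integrable_of_continuous _ (by fun_prop)),
    integral_add (integrable_of_continuous _ (by fun_prop)) (integrable_const _),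
    integral_const_mul, ← ha]
  simp
  ring

theorem mul_le_setIntegral_max_sub (ν : Measure I) [IsFiniteMeasure ν] {A : Set I} {a : I}
    (ha : ν.real A * a = ∫ x in A, (x : ℝ) ∂ν) (t : ℝ) :
    ν.real A * max (t - a) 0 ≤ ∫ x in A, max (t - (x : ℝ)) 0 ∂ν := by
  rw [mul_max_of_nonneg _ _ measureReal_nonneg, mul_zero]
  refine max_le ?_ (integral_nonneg fun x => le_max_right _ _)
  calc ν.real A * (t - a) = ∫ x in A, (t - (x : ℝ)) ∂ν := by
        rw [integral_sub (integrable_const _) (integrable_of_continuous _ (by fun_prop)), ← ha]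
        simp; ring
    _ ≤ ∫ x in A, max (t - (x : ℝ)) 0 ∂ν :=
        integral_mono (integrable_of_continuous _ (by fun_prop))
          (integrable_of_continuous _ (by fun_prop)) fun x => le_max_left _ _

/-- An optimal garbling at the second stage is supported on the conditional means given
`y ≤ x` and `x < y`: replacing the belief by these means has no effect on the selection and
saves attention costs. -/
theorem exists_ae_eq_or_eq_of_optimal {k : PosteriorDist μ → ℝ} {p q : PosteriorDist μ} {x : I}
    (hk : 0 < k p) (hq : IsGarbling q p)
    (hopt : ∀ q', IsGarbling q' p → stage₂Payoff k x p q' ≤ stage₂Payoff k x p q) :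
    ∃ a b : I, ∀ᵐ y ∂q.toMeasure, y = a ∨ y = b := by
  set A : Set I := Iic x
  have hA : MeasurableSet A := measurableSet_Iic
  obtain ⟨a, ha⟩ := exists_mul_eq_setIntegral q.toMeasure A
  obtain ⟨b, hb⟩ := exists_mul_eq_setIntegral q.toMeasure Aᶜ
  have split : ∀ {f : I → ℝ}, Continuous f → ∫ y, f y ∂q.toMeasure =
      ∫ y in A, f y ∂q.toMeasure + ∫ y in Aᶜ, f y ∂q.toMeasure := fun hf =>
    (integral_add_compl hA (integrable_of_continuous _ hf)).symm
  set w : I := ⟨q.toMeasure.real Aᶜ, measureReal_nonneg, measureReal_le_one⟩ with hw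
  have hw0 : (w : ℝ) = q.toMeasure.real Aᶜ := rfl
  have hw1 : 1 - (w : ℝ) = q.toMeasure.real A := by
    rw [hw0, probReal_compl_eq_one_sub hA]; ring
  have hmean : (1 - (w : ℝ)) * a + w * b = μ := by
    rw [hw1, hw0, ha, hb, ← split (by fun_prop), q.mean_eq]
  have hgarb : IsGarbling (twoPoint a b w hmean) q := by
    refine isGarbling_iff.2 fun t _ => ?_
    rw [integral_twoPoint, hw1, hw0, split (by fun_prop)]
    exact add_le_add (mul_le_setIntegral_max_sub _ ha t) (mul_le_setIntegral_max_sub _ hb t)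
  have hle := hopt _ (hgarb.trans hq)
  have hmax : ∫ y, max (x : ℝ) y ∂q.toMeasure ≤
      (1 - (w : ℝ)) * max (x : ℝ) a + w * max (x : ℝ) b := by
    rw [split (by fun_prop), hw1, hw0]
    refine add_le_add ?_ ?_
    · calc ∫ y in A, max (x : ℝ) y ∂q.toMeasure = ∫ _ in A, (x : ℝ) ∂q.toMeasure :=
            setIntegral_congr_fun hA fun y hy => max_eq_left (Subtype.coe_le_coe.2 hy)
        _ = q.toMeasure.real A * x := by simp
        _ ≤ _ := mul_le_mul_of_nonneg_left (le_max_left _ _) measureReal_nonneg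
    · calc ∫ y in Aᶜ, max (x : ℝ) y ∂q.toMeasure = ∫ y in Aᶜ, (y : ℝ) ∂q.toMeasure :=
            setIntegral_congr_fun hA.compl fun y hy =>
              max_eq_right (Subtype.coe_le_coe.2 (le_of_not_ge hy))
        _ = q.toMeasure.real Aᶜ * b := hb.symm
        _ ≤ _ := mul_le_mul_of_nonneg_left (le_max_right _ _) measureReal_nonneg
  have hvar : ∫ y, ((y : ℝ) - μ) ^ 2 ∂q.toMeasure =
      ∫ y in A, ((y : ℝ) - a) ^ 2 ∂q.toMeasure + ∫ y in Aᶜ, ((y : ℝ) - b) ^ 2 ∂q.toMeasure +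
        ((1 - (w : ℝ)) * ((a : ℝ) - μ) ^ 2 + w * ((b : ℝ) - μ) ^ 2) := by
    rw [split (by fun_prop), setIntegral_sq_sub _ ha, setIntegral_sq_sub _ hb, hw1, hw0]
    ring
  rw [stage₂Payoff, stage₂Payoff, cost, cost, integral_twoPoint, integral_twoPoint, hvar] at hle
  have hA0 : 0 ≤ ∫ y in A, ((y : ℝ) - a) ^ 2 ∂q.toMeasure := integral_nonneg fun _ => sq_nonneg _
  have hB0 : 0 ≤ ∫ y in Aᶜ, ((y : ℝ) - b) ^ 2 ∂q.toMeasure := integral_nonneg fun _ => sq_nonneg _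
  -- Collapsing each cell to its mean saves `k p` times the variance within cells, so optimality
  -- forces that variance to vanish.
  have hsum : ∫ y in A, ((y : ℝ) - a) ^ 2 ∂q.toMeasure +
      ∫ y in Aᶜ, ((y : ℝ) - b) ^ 2 ∂q.toMeasure ≤ 0 := by
    refine nonpos_of_mul_nonpos_right (a := k p) ?_ hk
    rw [mul_add] at hle
    linarith
  refine ⟨a, b, ae_of_ae_restrict_of_ae_restrict_compl A ?_ ?_⟩
  · have h := (integral_eq_zero_iff_of_nonneg (fun y : I => sq_nonneg ((y : ℝ) - a))
      (integrable_of_continuous _ (by fun_prop))).1 (le_antisymm (by linarith) hA0)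
    filter_upwards [h] with y hy
    exact Or.inl (Subtype.ext (sub_eq_zero.1 (pow_eq_zero_iff two_ne_zero |>.1 hy)))
  · have h := (integral_eq_zero_iff_of_nonneg (fun y : I => sq_nonneg ((y : ℝ) - b))
      (integrable_of_continuous _ (by fun_prop))).1 (le_antisymm (by linarith) hB0)
    filter_upwards [h] with y hy
    exact Or.inr (Subtype.ext (sub_eq_zero.1 (pow_eq_zero_iff two_ne_zero |>.1 hy)))

theorem stage₂Payoff_mix (k : PosteriorDist μ → ℝ) (x : I) (p q q' : PosteriorDist μ) :
    stage₂Payoff k x p (mix q q') = (stage₂Payoff k x p q + stage₂Payoff k x p q') / 2 := by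
  rw [stage₂Payoff, cost, integral_mix _ _ (by fun_prop), integral_mix _ _ (by fun_prop)]
  simp only [stage₂Payoff, cost]
  ring

/-- The optimal garbling at the second stage is unique. -/
theorem eq_of_optimal {k : PosteriorDist μ → ℝ} {p q q' : PosteriorDist μ} {x : I}
    (hk : 0 < k p) (hq : IsGarbling q p) (hq' : IsGarbling q' p)
    (hopt : ∀ r, IsGarbling r p → stage₂Payoff k x p r ≤ stage₂Payoff k x p q)
    (hopt' : ∀ r, IsGarbling r p → stage₂Payoff k x p r ≤ stage₂Payoff k x p q') : q = q' := by
  -- The payoff is affine in the garbling, so the mixture is optimal too; its two support points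
  -- then carry both `q` and `q'`.
  obtain ⟨a, b, h⟩ := exists_ae_eq_or_eq_of_optimal (x := x) hk (mix_isGarbling hq hq')
    fun r hr => by
      rw [stage₂Payoff_mix]
      linarith [hopt r hr, hopt' r hr]
  have h2 : (2⁻¹ : ENNReal) ≠ 0 := by simp
  have h' := (Measure.ae_ennreal_smul_measure_iff h2).1 h
  rw [ae_add_measure_iff] at h'
  exact PosteriorDist.eq_of_ae_eq_or_eq h'.1 h'.2

/-- A distribution of posteriors, as a point of the compact space of probability measures. -/
def PosteriorDist.toProbabilityMeasure (p : PosteriorDist μ) : ProbabilityMeasure I :=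
  ⟨p.toMeasure, p.isProb⟩

/-- The set of garblings of `p`. -/
def garblings (p : PosteriorDist μ) : Set (ProbabilityMeasure I) :=
  {ν | ∃ q, IsGarbling q p ∧ q.toProbabilityMeasure = ν}

theorem continuous_integral {f : I → ℝ} (hf : Continuous f) :
    Continuous fun ν : ProbabilityMeasure I => ∫ x, f x ∂(ν : Measure I) :=
  ProbabilityMeasure.continuous_integral_continuousMap (⟨f, hf⟩ : C(I, ℝ))

theorem isClosed_garblings (p : PosteriorDist μ) : IsClosed (garblings p) := by
  have h : garblings p =
      {ν : ProbabilityMeasure I | ∫ x : I, (x : ℝ) ∂(ν : Measure I) = μ} ∩ ⋂ t ∈ Icc (0 : ℝ) 1,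
      {ν : ProbabilityMeasure I | ∫ x : I, max (t - x) 0 ∂(ν : Measure I) ≤ ∫ x : I, max (t - x) 0 ∂p.toMeasure} := by
    ext ν
    simp only [mem_inter_iff, mem_iInter]
    constructor
    · rintro ⟨q, hq, rfl⟩
      exact ⟨q.mean_eq, isGarbling_iff.1 hq⟩
    · rintro ⟨h1, h2⟩
      exact ⟨⟨ν, inferInstance, h1⟩, isGarbling_iff.2 h2, rfl⟩
  rw [h]
  refine (isClosed_eq (continuous_integral (by fun_prop)) continuous_const).inter
    (isClosed_biInter fun t _ => ?_)
  exact isClosed_le (continuous_integral (by fun_prop)) continuous_const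

/-- `stage₂Payoff` as a function of the belief and of the measure, with unit cost `c`. -/
noncomputable def selectionValue (μ : I) (c : ℝ) (z : I × ProbabilityMeasure I) : ℝ :=
  (∫ y, max (z.1 : ℝ) (y : ℝ) ∂(z.2 : Measure I)) - c * ∫ y, ((y : ℝ) - μ) ^ 2 ∂(z.2 : Measure I)

theorem continuous_selectionValue (c : ℝ) : Continuous (selectionValue μ c) := by
  refine Continuous.sub ?_ (continuous_const.mul
    ((continuous_integral (f := fun y : I => ((y : ℝ) - μ) ^ 2) (by fun_prop)).comp
      continuous_snd))
  -- Joint continuity: weakly continuous in the measure, and 1-Lipschitz in the belief for every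
  -- measure.
  refine continuous_prod_of_continuous_lipschitzWith _ 1 (fun x => ?_) fun ν => ?_
  · exact continuous_integral (f := fun y : I => max (x : ℝ) y) (by fun_prop)
  · refine LipschitzWith.of_dist_le_mul fun x x' => ?_
    rw [NNReal.coe_one, one_mul, Real.dist_eq, Subtype.dist_eq, Real.dist_eq,
      ← integral_sub (integrable_of_continuous _ (by fun_prop))
        (integrable_of_continuous _ (by fun_prop))]
    have h := norm_integral_le_of_norm_le_const (μ := (ν : Measure I))
      (f := fun y : I => max (x : ℝ) y - max (x' : ℝ) y) (C := |(x : ℝ) - x'|)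
      (Eventually.of_forall fun y : I => abs_max_sub_max_le_abs (x : ℝ) x' y)
    rwa [probReal_univ, mul_one] at h

theorem exists_optimal (k : PosteriorDist μ → ℝ) (p : PosteriorDist μ) (x : I) :
    ∃ q, IsGarbling q p ∧
      ∀ r, IsGarbling r p → stage₂Payoff k x p r ≤ stage₂Payoff k x p q := by
  obtain ⟨_, ⟨q, hq, rfl⟩, hmax⟩ := (isClosed_garblings p).isCompact.exists_isMaxOn
    ⟨_, p, IsGarbling.refl p, rfl⟩
    (f := fun ν => selectionValue μ (k p) (x, ν))
    ((continuous_selectionValue (k p)).comp (Continuous.prodMk_right x)).continuousOn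
  exact ⟨q, hq, fun r hr => hmax ⟨r, hr, rfl⟩⟩

/-- The optimal garbling at the second stage. -/
noncomputable def bestGarbling (k : PosteriorDist μ → ℝ) (p : PosteriorDist μ) (x : I) :
    PosteriorDist μ :=
  (exists_optimal k p x).choose

theorem bestGarbling_isGarbling (k : PosteriorDist μ → ℝ) (p : PosteriorDist μ) (x : I) :
    IsGarbling (bestGarbling k p x) p :=
  (exists_optimal k p x).choose_spec.1

theorem stage₂Payoff_le_bestGarbling (k : PosteriorDist μ → ℝ) (p : PosteriorDist μ) (x : I)
    {r : PosteriorDist μ} (hr : IsGarbling r p) :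
    stage₂Payoff k x p r ≤ stage₂Payoff k x p (bestGarbling k p x) :=
  (exists_optimal k p x).choose_spec.2 r hr

/-- Uniqueness identifies the graph of the selection with the set of all maximizers, which is
closed; compactness then gives continuity. -/
theorem measurable_bestGarbling {k : PosteriorDist μ → ℝ} {p : PosteriorDist μ} (hk : 0 < k p) :
    Measurable fun x => (bestGarbling k p x).toMeasure := by
  refine measurable_toMeasure_of_continuous
    (f := fun x => (bestGarbling k p x).toProbabilityMeasure) (continuous_of_isClosed_graph ?_)
  have h : {z : I × ProbabilityMeasure I | z.2 = (bestGarbling k p z.1).toProbabilityMeasure} =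
      {z | z.2 ∈ garblings p} ∩ ⋂ r ∈ {r | IsGarbling r p},
        {z | selectionValue μ (k p) (z.1, r.toProbabilityMeasure) ≤
          selectionValue μ (k p) z} := by
    ext ⟨x, ν⟩
    simp only [mem_inter_iff, mem_iInter, mem_ofPred_eq]
    constructor
    · rintro rfl
      exact ⟨⟨_, bestGarbling_isGarbling k p x, rfl⟩,
        fun r hr => stage₂Payoff_le_bestGarbling k p x hr⟩
    · rintro ⟨⟨q, hq, rfl⟩, h⟩
      exact congrArg PosteriorDist.toProbabilityMeasure (eq_of_optimal hk hq (bestGarbling_isGarbling k p x) h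
        fun r => stage₂Payoff_le_bestGarbling k p x)
  rw [h]
  refine ((isClosed_garblings p).preimage continuous_snd).inter (isClosed_biInter fun r _ => ?_)
  have hc := continuous_selectionValue (μ := μ) (k p)
  exact isClosed_le (hc.comp (by fun_prop)) hc

/-! ### Bounds on the receiver's payoffs -/

/-- If an objective net of the attention cost lies below an affine function, then its
expectation is at most the value of the affine function at the prior. -/
theorem integral_sub_cost_le {k : PosteriorDist μ → ℝ} {p : PosteriorDist μ} {f : I → ℝ} {α β : ℝ}
    (hk : 0 ≤ k p) (hα : 0 ≤ α)
    (h : ∀ y : I, f y - k p * ((y : ℝ) - μ) ^ 2 ≤ α + β * ((y : ℝ) - μ)) (q : PosteriorDist μ) :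
    ∫ y, f y ∂q.toMeasure - cost k p q ≤ α := by
  have hsq : Continuous fun y : I => ((y : ℝ) - μ) ^ 2 := by fun_prop
  have haff : Continuous fun y : I => (y : ℝ) - μ := by fun_prop
  by_cases hf : Integrable f q.toMeasure
  · rw [cost, ← integral_const_mul,
      ← integral_sub hf ((integrable_of_continuous _ hsq).const_mul _)]
    calc ∫ y, (f y - k p * ((y : ℝ) - μ) ^ 2) ∂q.toMeasure
        ≤ ∫ y, (α + β * ((y : ℝ) - μ)) ∂q.toMeasure :=
          integral_mono (hf.sub ((integrable_of_continuous _ hsq).const_mul _))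
            (integrable_of_continuous _ (by fun_prop)) h
      _ = α := by
          rw [integral_add (integrable_const _) ((integrable_of_continuous _ haff).const_mul _),
            integral_const_mul,
            integral_sub (integrable_of_continuous _ (by fun_prop)) (integrable_const _), q.mean_eq]
          simp
  -- The integral is then 0 by convention, and `0 ≤ α` suffices; this spares proving continuation
  -- payoffs integrable.
  · rw [integral_undef hf]
    have : 0 ≤ cost k p q := mul_nonneg hk (integral_nonneg fun _ => sq_nonneg _)
    linarith

/-- The majorant is the common tangent of the parabolas `x - k (y - μ)²` and `y - k (y - μ)²`,
touching them at `y = x - δ` and `y = x + δ`. -/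
theorem stage₂Payoff_le {k : PosteriorDist μ → ℝ} {p : PosteriorDist μ} {δ : ℝ}
    (hk : 0 < k p) (hδ : 4 * k p * δ = 1) (x : I) (q : PosteriorDist μ) :
    stage₂Payoff k x p q ≤ x + k p * (x - μ - δ) ^ 2 := by
  refine integral_sub_cost_le (β := -(2 * k p * (x - μ - δ))) hk.le
    (add_nonneg x.2.1 (by positivity)) (fun y => ?_) q
  rw [sub_le_iff_le_add]
  refine max_le ?_ ?_
  · nlinarith [mul_nonneg hk.le (sq_nonneg ((x : ℝ) - μ - δ - (y - μ)))]
  · linear_combination mul_nonneg hk.le (sq_nonneg ((y : ℝ) - x - δ)) - ((y : ℝ) - x) * hδ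

/-- For beliefs this far from `μ`, the tangent at the prior (slope 0 above `μ`, slope 1 below)
already majorizes both parabolas, so further learning does not pay. -/
theorem stage₂Payoff_le_max {k : PosteriorDist μ → ℝ} {p : PosteriorDist μ} {δ : ℝ}
    (hk : 0 < k p) (hδ : 4 * k p * δ = 1) {x : I} (hx : δ ≤ |(x : ℝ) - μ|) (q : PosteriorDist μ) :
    stage₂Payoff k x p q ≤ max (x : ℝ) μ := by
  rcases le_abs.1 hx with h | h
  · refine le_trans ?_ (le_max_left _ _)
    refine integral_sub_cost_le (β := 0) hk.le x.2.1 (fun y => ?_) q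
    rw [sub_le_iff_le_add]
    refine max_le ?_ ?_
    · nlinarith [mul_nonneg hk.le (sq_nonneg ((y : ℝ) - μ))]
    · linear_combination h + mul_nonneg hk.le (sq_nonneg ((y : ℝ) - μ - 2 * δ)) +
        (δ - ((y : ℝ) - μ)) * hδ
  · refine le_trans ?_ (le_max_right _ _)
    refine integral_sub_cost_le (β := 1) hk.le μ.2.1 (fun y => ?_) q
    rw [sub_le_iff_le_add]
    refine max_le ?_ ?_
    · linear_combination h + mul_nonneg hk.le (sq_nonneg ((y : ℝ) - μ + 2 * δ)) +
        (δ + ((y : ℝ) - μ)) * hδ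
    · nlinarith [mul_nonneg hk.le (sq_nonneg ((y : ℝ) - μ))]

theorem stage₂Payoff_noInfo (k : PosteriorDist μ → ℝ) (x : I) (p : PosteriorDist μ) :
    stage₂Payoff k x p (noInfo μ) = max (x : ℝ) μ := by
  simp [stage₂Payoff, cost, integral_noInfo]

/-! ### The equilibrium -/

/-- The distribution with mass `1 / 2` on each of `μ - δ` and `μ + δ`. -/
noncomputable def spread (μ : I) (δ : ℝ) (hl : (μ : ℝ) - δ ∈ I) (hr : (μ : ℝ) + δ ∈ I) :
    PosteriorDist μ :=
  twoPoint ⟨μ - δ, hl⟩ ⟨μ + δ, hr⟩ ⟨1 / 2, by norm_num, by norm_num⟩ (by simp; ring)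

theorem integral_spread {δ : ℝ} (hl : (μ : ℝ) - δ ∈ I) (hr : (μ : ℝ) + δ ∈ I) (f : I → ℝ) :
    ∫ x, f x ∂(spread μ δ hl hr).toMeasure = (f ⟨μ - δ, hl⟩ + f ⟨μ + δ, hr⟩) / 2 := by
  rw [spread, integral_twoPoint]
  ring

open Classical in
/-- The receiver visits either sender first with probability `1 / 2`. If he offers full
information, she learns enough about him to stop; otherwise she learns nothing and continues. -/
noncomputable def receiverStrategy (k : PosteriorDist μ → ℝ) (hk : ∀ p, 0 < k p) (δ : ℝ)
    (hl : (μ : ℝ) - δ ∈ I) (hr : (μ : ℝ) + δ ∈ I) : ReceiverStrategy μ where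
  order := (PMF.uniformOfFintype (Fin 2)).map some
  garble₁ _ p := if p = fullInfo μ then spread μ δ hl hr else noInfo μ
  garble₁_isGarbling _ p := by
    split_ifs with h
    · exact h ▸ isGarbling_fullInfo _
    · exact noInfo_isGarbling p
  -- The inequality is strict: at exactly `μ ± δ` she stops.
  goOn _ := {x | |(x : ℝ) - μ| < δ}
  measurableSet_goOn _ := measurableSet_lt (by fun_prop) (by fun_prop)
  -- The optimum is made explicit at the only belief where the second garbling affects the
  -- equilibrium or a unilateral deviation.
  garble₂ _ p x := if p = fullInfo μ ∧ x = μ then spread μ δ hl hr else bestGarbling k p x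
  garble₂_isGarbling _ p x := by
    split_ifs with h
    · exact h.1 ▸ isGarbling_fullInfo _
    · exact bestGarbling_isGarbling k p x
  measurable_garble₂ _ p := by
    by_cases hp : p = fullInfo μ
    · simp only [hp, true_and, apply_ite PosteriorDist.toMeasure]
      exact Measurable.ite (measurableSet_singleton μ) measurable_const
        (measurable_bestGarbling (hk _))
    · simpa only [hp, false_and, if_false] using measurable_bestGarbling (hk p)
  selectUnvisited := ⟨1 / 2, by norm_num, by norm_num⟩
  tie _ := ⟨1 / 2, by norm_num, by norm_num⟩

section

variable {k : PosteriorDist μ → ℝ} (hk : ∀ p, 0 < k p) {δ : ℝ} (hl : (μ : ℝ) - δ ∈ I)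
  (hr : (μ : ℝ) + δ ∈ I)

theorem stage₂Payoff_spread (p : PosteriorDist μ) (hδ : 0 ≤ δ) (hp : 4 * k p * δ = 1) :
    stage₂Payoff k μ p (spread μ δ hl hr) = μ + δ / 4 := by
  rw [stage₂Payoff, cost, integral_spread, integral_spread]
  simp only
  rw [max_eq_left (by linarith : (μ : ℝ) - δ ≤ μ), max_eq_right (by linarith : (μ : ℝ) ≤ μ + δ)]
  linear_combination (-δ / 4) * hp

theorem stage₂Payoff_le_garble₂ (hδ : 0 ≤ δ) (hF : 4 * k (fullInfo μ) * δ = 1) (i : Fin 2)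
    (p : PosteriorDist μ) (x : I) {q : PosteriorDist μ} (hq : IsGarbling q p) :
    stage₂Payoff k x p q ≤
      stage₂Payoff k x p ((receiverStrategy k hk δ hl hr).garble₂ i p x) := by
  simp only [receiverStrategy]
  split_ifs with h
  · obtain ⟨rfl, rfl⟩ := h
    rw [stage₂Payoff_spread hl hr _ hδ hF]
    refine (stage₂Payoff_le (hk _) hF _ q).trans_eq ?_
    linear_combination (δ / 4) * hF
  · exact stage₂Payoff_le_bestGarbling k p x hq

theorem continuation_of_mem {i : Fin 2} {p : PosteriorDist μ} {x : I} (hx : |(x : ℝ) - μ| < δ) :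
    continuation k (receiverStrategy k hk δ hl hr) i p x =
      stage₂Payoff k x p ((receiverStrategy k hk δ hl hr).garble₂ i p x) :=
  if_pos hx

theorem continuation_of_notMem {i : Fin 2} {p : PosteriorDist μ} {x : I}
    (hx : δ ≤ |(x : ℝ) - μ|) :
    continuation k (receiverStrategy k hk δ hl hr) i p x = max (x : ℝ) μ :=
  if_neg (not_lt.2 hx)

theorem continuation_prior (hδ : 0 < δ) (hF : 4 * k (fullInfo μ) * δ = 1) (i : Fin 2) :
    continuation k (receiverStrategy k hk δ hl hr) i (fullInfo μ) μ = μ + δ / 4 := by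
  rw [continuation_of_mem hk hl hr (by simpa using hδ), ← stage₂Payoff_spread hl hr _ hδ.le hF]
  simp [receiverStrategy]

theorem stage₁Payoff_le (hδ : 0 < δ) (hF : 4 * k (fullInfo μ) * δ = 1) {p : PosteriorDist μ}
    (hp : k (fullInfo μ) ≤ k p) (i : Fin 2) (q : PosteriorDist μ) :
    stage₁Payoff k (receiverStrategy k hk δ hl hr) i p (fullInfo μ) q ≤ μ + δ / 4 := by
  refine integral_sub_cost_le (β := 1 / 2) (hk p).le (add_nonneg μ.2.1 (by positivity))
    (fun x => ?_) q
  have h := mul_le_mul_of_nonneg_right hp (sq_nonneg ((x : ℝ) - μ))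
  rw [sub_le_iff_le_add]
  rcases lt_or_ge |(x : ℝ) - μ| δ with hx | hx
  · rw [continuation_of_mem hk hl hr hx]
    refine (stage₂Payoff_le (hk _) hF x _).trans ?_
    -- With cost factor `k_F` the squares cancel and the second-stage bound net of cost is exactly
    -- `μ + δ / 4 + (x - μ) / 2`: learning now or later is equivalent. Outside this region the same
    -- line is tangent at `μ ± δ`.
    linear_combination h + (δ / 4 - ((x : ℝ) - μ) / 2) * hF
  · rw [continuation_of_notMem hk hl hr hx]
    have hF' := hk (fullInfo μ)
    refine max_le ?_ ?_
    · linear_combination h + mul_nonneg hF'.le (sq_nonneg ((x : ℝ) - μ - δ)) -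
        (((x : ℝ) - μ) / 2 - δ / 4) * hF
    · linear_combination h + mul_nonneg hF'.le (sq_nonneg ((x : ℝ) - μ + δ)) +
        (((x : ℝ) - μ) / 2 + δ / 4) * hF

theorem stage₁Payoff_garble₁ (hδ : 0 < δ) (hF : 4 * k (fullInfo μ) * δ = 1) (i : Fin 2)
    (p : PosteriorDist μ) :
    stage₁Payoff k (receiverStrategy k hk δ hl hr) i p (fullInfo μ)
      ((receiverStrategy k hk δ hl hr).garble₁ i p) = μ + δ / 4 := by
  by_cases hp : p = fullInfo μ
  · have hg : (receiverStrategy k hk δ hl hr).garble₁ i p = spread μ δ hl hr := if_pos hp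
    rw [hg, hp, stage₁Payoff, cost, integral_spread, integral_spread,
      continuation_of_notMem hk hl hr (by simp [abs_of_pos hδ]),
      continuation_of_notMem hk hl hr (by simp [abs_of_pos hδ])]
    simp only
    rw [max_eq_right (by linarith : (μ : ℝ) - δ ≤ μ), max_eq_left (by linarith : (μ : ℝ) ≤ μ + δ)]
    linear_combination (-δ / 4) * hF
  · have hg : (receiverStrategy k hk δ hl hr).garble₁ i p = noInfo μ := if_neg hp
    rw [hg, stage₁Payoff, cost, integral_noInfo, integral_noInfo,
      continuation_prior hk hl hr hδ hF]
    simp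

/-- Each sender wins with probability `1 / 2`, unless both deviate from full information. -/
theorem winFirst_eq_half (hδ : 0 < δ) (i : Fin 2) {p p' : PosteriorDist μ}
    (h : p = fullInfo μ ∨ p' = fullInfo μ) :
    winFirst (receiverStrategy k hk δ hl hr) i p p' = 1 / 2 := by
  have hlt : (⟨(μ : ℝ) - δ, hl⟩ : I) < μ := Subtype.coe_lt_coe.1 (sub_lt_self _ hδ)
  have hgt : μ < (⟨(μ : ℝ) + δ, hr⟩ : I) := Subtype.coe_lt_coe.1 (lt_add_of_pos_right _ hδ)
  by_cases hp : p = fullInfo μ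
  · have hg : (receiverStrategy k hk δ hl hr).garble₁ i p = spread μ δ hl hr := if_pos hp
    rw [winFirst, hg, integral_spread]
    simp [receiverStrategy, abs_of_pos hδ, selectFirst, hlt, hgt, hlt.not_gt]
  · have hg : (receiverStrategy k hk δ hl hr).garble₁ i p = noInfo μ := if_neg hp
    have hg' : (receiverStrategy k hk δ hl hr).garble₂ i p' μ = spread μ δ hl hr :=
      if_pos ⟨h.resolve_left hp, rfl⟩
    rw [winFirst, hg, integral_noInfo, hg', integral_spread]
    simp [receiverStrategy, hδ, selectFirst, hlt, hgt, hgt.not_gt]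

theorem receiverOptimal (hδ : 0 < δ) (hF : 4 * k (fullInfo μ) * δ = 1)
    (hle : ∀ p, k (fullInfo μ) ≤ k p) :
    ReceiverOptimal k (fun _ => fullInfo μ) (receiverStrategy k hk δ hl hr) where
  garble₂_opt i p x _ hq := stage₂Payoff_le_garble₂ hk hl hr hδ.le hF i p x hq
  goOn_opt i x := by
    rcases lt_or_ge |(x : ℝ) - μ| δ with hx | hx
    · rw [continuation_of_mem hk hl hr hx]
      refine ⟨le_rfl, ?_⟩
      rw [← stage₂Payoff_noInfo k x (fullInfo μ)]
      exact stage₂Payoff_le_garble₂ hk hl hr hδ.le hF i _ x (noInfo_isGarbling _)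
    · rw [continuation_of_notMem hk hl hr hx]
      exact ⟨stage₂Payoff_le_max (hk _) hF hx _, le_rfl⟩
  garble₁_opt i p q _ := by
    rw [stage₁Payoff_garble₁ hk hl hr hδ hF]
    exact stage₁Payoff_le hk hl hr hδ hF (hle p) i q
  order_opt o ho o' := by
    have h : ∀ i, orderPayoff k (fun _ => fullInfo μ) (receiverStrategy k hk δ hl hr) (some i) =
        μ + δ / 4 := fun i => stage₁Payoff_garble₁ hk hl hr hδ hF i _
    obtain ⟨i, -, rfl⟩ := (PMF.mem_support_map_iff _ _ _).1 ho
    rw [h]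
    rcases o' with _ | j
    · simp only [orderPayoff]
      linarith
    · rw [h]

end

end DisclosureGame

theorem mainTheorem6 (μ : unitInterval)
    (k : DisclosureGame.PosteriorDist μ → ℝ)
    (hk : ∀ p q : DisclosureGame.PosteriorDist μ, DisclosureGame.IsGarbling q p → k p ≤ k q)
    (hF : 1 / 2 < k (DisclosureGame.fullInfo μ))
    (hμ : (μ : ℝ) ∈ Set.Icc (1 / (4 * k (DisclosureGame.fullInfo μ)))
      (1 - 1 / (4 * k (DisclosureGame.fullInfo μ)))) :
    ∃ ρ : DisclosureGame.ReceiverStrategy μ,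
      DisclosureGame.IsEquilibrium k (fun _ => DisclosureGame.fullInfo μ) ρ := by
  open DisclosureGame in
  have hle : ∀ p, k (fullInfo μ) ≤ k p := fun p => hk _ _ (isGarbling_fullInfo p)
  have hF0 : 0 < k (fullInfo μ) := by linarith
  have hpos : ∀ p, 0 < k p := fun p => hF0.trans_le (hle p)
  obtain ⟨δ, hδ⟩ : ∃ δ, δ = 1 / (4 * k (fullInfo μ)) := ⟨_, rfl⟩
  have hδ0 : 0 < δ := by rw [hδ]; positivity
  have h4 : 4 * k (fullInfo μ) * δ = 1 := by rw [hδ]; field_simp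
  rw [← hδ] at hμ
  have h0 := μ.2.1
  have h1 := μ.2.2
  have hl : (μ : ℝ) - δ ∈ unitInterval := ⟨by linarith [hμ.1], by linarith⟩
  have hr : (μ : ℝ) + δ ∈ unitInterval := ⟨by linarith, by linarith [hμ.2]⟩
  refine ⟨receiverStrategy k hpos δ hl hr, receiverOptimal hpos hl hr hδ0 h4 hle,
    fun i p => le_of_eq ?_⟩
  refine Finset.sum_congr rfl fun o _ => congrArg _ ?_
  rcases o with _ | j
  · rfl
  · have hne : other j ≠ j := by fin_cases j <;> decide
    -- After a unilateral deviation someone still offers full information, so every term of the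
    -- payoff sum is unchanged.
    have hor : Function.update (fun _ => fullInfo μ) i p j = fullInfo μ ∨
        Function.update (fun _ => fullInfo μ) i p (other j) = fullInfo μ := by
      by_cases hj : j = i
      · exact Or.inr (Function.update_of_ne (hj ▸ hne) _ _)
      · exact Or.inl (Function.update_of_ne hj _ _)
    simp only [winGiven, winFirst_eq_half hpos hl hr hδ0 j hor,
      winFirst_eq_half hpos hl hr hδ0 j (p := fullInfo μ) (Or.inl rfl)]
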